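/- Let $G$ be a finitely generated group acting by isometries on a nonempty proper geodesic metric space $X$. Suppose that the action is free ($g\cdot x\ne x$ for all $x\in X$ and all $g\in G$ with $g\neq 1$), properly discontinuous (for all compact $K,L\subseteq X$ the set $\{g\in G: gK\cap L\neq\emptyset\}$ is finite) and cocompact (there is a compact $K\subseteq X$ with $\bigcup_{g\in G} gK=X$). Let $N\subseteq X$ be a net, that is, there are $a,b>0$ such that $d(x,y)\ge a$ for all distinct $x,y\in N$ and every point of $X$ is at distance at most $b$ from some point of $N$; if $G$ is finite, assume in addition that $|N|=|G|$ (nothing is assumed on $|N|$ if $G$ is infinite). Equip $G$ with the word metric $d_S(g,h)=\min\{n\ge 0: g=hs_1\cdots s_n \text{ for some } s_1,\dots,s_n\in S\}$ of any finite symmetric generating set $S$. Then the Lipschitz-free spaces $\mathcal F(N)$ and $\mathcal F(G)$ are isomorphic as Banach spaces (there is a linear homeomorphism between them), for any choice of base points. Here, for a metric space $M$ with base point $0$, $\mathrm{Lip}_0(M)$ is the Banach space of real-valued Lipschitz functions on $M$ vanishing at $0$, normed by the minimal Lipschitz constant, and $\mathcal F(M)$ is the closed linear span of the evaluation functionals $\delta(x):f\mapsto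 f(x)$, $x\in M$, in the dual space $\mathrm{Lip}_0(M)^*$. -/

import Mathlib

noncomputable section

/-! ### Lipschitz-free spaces -/

/-- The real-valued Lipschitz functions on `M` that vanish at the base point `o`, as a linear
subspace of the space of all functions. -/
def lipZeroSubmodule (M : Type*) [MetricSpace M] (o : M) : Submodule ℝ (M → ℝ) where
  carrier := {f | f o = 0 ∧ ∃ K : ℝ, 0 ≤ K ∧ ∀ x y, |f x - f y| ≤ K * dist x y}
  zero_mem' := ⟨rfl, 0, le_rfl, fun x y => by simp⟩
  add_mem' := by
    rintro f g ⟨hf, K, hK, hfK⟩ ⟨hg, L, hL, hgL⟩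
    refine ⟨by simp [hf, hg], K + L, by positivity, fun x y => ?_⟩
    have h : (f + g) x - (f + g) y = (f x - f y) + (g x - g y) := by
      simp only [Pi.add_apply]; ring
    rw [h]
    calc _ ≤ |f x - f y| + |g x - g y| := abs_add_le _ _
      _ ≤ K * dist x y + L * dist x y := add_le_add (hfK x y) (hgL x y)
      _ = _ := by ring
  smul_mem' := by
    rintro c f ⟨hf, K, hK, hfK⟩
    refine ⟨by simp [hf], |c| * K, by positivity, fun x y => ?_⟩
    have h : (c • f) x - (c • f) y = c * (f x - f y) := by
      simp only [Pi.smul_apply, smul_eq_mul]; ring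
    rw [h, abs_mul, mul_assoc]
    exact mul_le_mul_of_nonneg_left (hfK x y) (abs_nonneg c)

/-- The space `Lip₀(M)`; it is a type of its own so that it carries the Lipschitz norm rather than
the topology of pointwise convergence. -/
def LipZero (M : Type*) [MetricSpace M] (o : M) : Type _ := ↥(lipZeroSubmodule M o)

namespace LipZero

variable {M : Type*} [MetricSpace M] {o : M}

instance : AddCommGroup (LipZero M o) := inferInstanceAs (AddCommGroup ↥(lipZeroSubmodule M o))

instance : Module ℝ (LipZero M o) := inferInstanceAs (Module ℝ ↥(lipZeroSubmodule M o))

instance : CoeFun (LipZero M o) (fun _ => M → ℝ) := ⟨fun f => f.1⟩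

@[simp] theorem add_apply (f g : LipZero M o) (x : M) : (f + g) x = f x + g x := rfl

@[simp] theorem smul_apply (c : ℝ) (f : LipZero M o) (x : M) : (c • f) x = c * f x := rfl

theorem apply_base (f : LipZero M o) : f o = 0 := f.2.1

/-- The Lipschitz constants of `f`. -/
def constants (f : LipZero M o) : Set ℝ := {K | 0 ≤ K ∧ ∀ x y, |f x - f y| ≤ K * dist x y}

/-- The norm of `f` is its minimal Lipschitz constant. -/
instance : Norm (LipZero M o) := ⟨fun f => sInf f.constants⟩

theorem constants_nonempty (f : LipZero M o) : f.constants.Nonempty := f.2.2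

theorem norm_nonneg' (f : LipZero M o) : 0 ≤ ‖f‖ := Real.sInf_nonneg fun _ hK => hK.1

theorem abs_sub_le (f : LipZero M o) (x y : M) : |f x - f y| ≤ ‖f‖ * dist x y := by
  rcases eq_or_ne x y with rfl | hxy
  · simp
  · have hd : 0 < dist x y := dist_pos.2 hxy
    rw [← div_le_iff₀ hd]
    refine le_csInf f.constants_nonempty fun K hK => ?_
    rw [div_le_iff₀ hd]
    exact hK.2 x y

theorem norm_le (f : LipZero M o) {K : ℝ} (hK : 0 ≤ K)
    (h : ∀ x y, |f x - f y| ≤ K * dist x y) : ‖f‖ ≤ K :=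
  csInf_le ⟨0, fun _ hL => hL.1⟩ ⟨hK, h⟩

theorem norm_smul_le' (c : ℝ) (f : LipZero M o) : ‖c • f‖ ≤ |c| * ‖f‖ := by
  refine norm_le _ (mul_nonneg (abs_nonneg c) (norm_nonneg' f)) fun x y => ?_
  have h : (c • f) x - (c • f) y = c * (f x - f y) := by simp only [smul_apply]; ring
  rw [h, abs_mul, mul_assoc]
  exact mul_le_mul_of_nonneg_left (abs_sub_le f x y) (abs_nonneg c)

theorem normedSpaceCore : NormedSpace.Core ℝ (LipZero M o) where
  norm_nonneg := norm_nonneg'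
  norm_smul c f := by
    rw [Real.norm_eq_abs]
    refine le_antisymm (norm_smul_le' c f) ?_
    rcases eq_or_ne c 0 with rfl | hc
    · simpa using norm_nonneg' ((0 : ℝ) • f)
    · have h := norm_smul_le' c⁻¹ (c • f)
      rw [smul_smul, inv_mul_cancel₀ hc, one_smul, abs_inv] at h
      have hc' : 0 < |c| := abs_pos.2 hc
      calc |c| * ‖f‖ ≤ |c| * (|c|⁻¹ * ‖c • f‖) := mul_le_mul_of_nonneg_left h hc'.le
        _ = ‖c • f‖ := by rw [← mul_assoc, mul_inv_cancel₀ hc'.ne', one_mul]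
  norm_triangle f g := by
    refine norm_le _ (add_nonneg (norm_nonneg' f) (norm_nonneg' g)) fun x y => ?_
    have h : (f + g) x - (f + g) y = (f x - f y) + (g x - g y) := by
      simp only [add_apply]; ring
    rw [h, add_mul]
    exact (abs_add_le _ _).trans (add_le_add (abs_sub_le f x y) (abs_sub_le g x y))
  norm_eq_zero_iff f := by
    constructor
    · intro h
      refine Subtype.ext (funext fun x => ?_)
      have hx := abs_sub_le f x o
      rw [h, zero_mul, apply_base, sub_zero] at hx
      exact abs_nonpos_iff.1 hx
    · rintro rfl
      refine le_antisymm (norm_le _ le_rfl fun x y => ?_) (norm_nonneg' _)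
      have h0 : ∀ z : M, (0 : LipZero M o) z = 0 := fun _ => rfl
      simp [h0]

instance : NormedAddCommGroup (LipZero M o) := NormedAddCommGroup.ofCore normedSpaceCore

instance : NormedSpace ℝ (LipZero M o) := NormedSpace.ofCore normedSpaceCore

/-- The evaluation functional `δ(x) : f ↦ f x` in the dual of `Lip₀(M)`. -/
def eval (o x : M) : StrongDual ℝ (LipZero M o) :=
  LinearMap.mkContinuous
    { toFun := fun f => f x
      map_add' := fun _ _ => rfl
      map_smul' := fun _ _ => rfl }
    (dist x o)
    (fun f => by
      have h := abs_sub_le f x o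
      rw [apply_base, sub_zero, mul_comm] at h
      exact h)

end LipZero

/-- The Lipschitz-free space `𝓕(M)` over the metric space `M` with base point `o`: the closed linear
span of the evaluation functionals in the dual of `Lip₀(M)`, with the dual norm. -/
abbrev LipschitzFree (M : Type*) [MetricSpace M] (o : M) : Type _ :=
  ↥(Submodule.span ℝ (Set.range (LipZero.eval o))).topologicalClosure

/-! ### Word metrics -/

/-- A finite symmetric generating set of the group `G`. -/
structure SymmGenSet (G : Type*) [Group G] where
  carrier : Set G
  finite : carrier.Finite
  inv_mem : ∀ s ∈ carrier, s⁻¹ ∈ carrier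
  closure_eq : Subgroup.closure carrier = ⊤

/-- The least length of a word `s₁ ⋯ sₙ` in the letters of `S` with `g = h s₁ ⋯ sₙ`. -/
def wordDist {G : Type*} [Group G] (S : SymmGenSet G) (g h : G) : ℕ :=
  sInf {n | ∃ w : List G, w.length = n ∧ (∀ s ∈ w, s ∈ S.carrier) ∧ g = h * w.prod}

section wordDist

variable {G : Type*} [Group G] (S : SymmGenSet G)

theorem wordDist_le (g h : G) (w : List G) (hw : ∀ s ∈ w, s ∈ S.carrier) (e : g = h * w.prod) :
    wordDist S g h ≤ w.length := Nat.sInf_le ⟨w, rfl, hw, e⟩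

theorem exists_word (g h : G) :
    ∃ w : List G, w.length = wordDist S g h ∧ (∀ s ∈ w, s ∈ S.carrier) ∧ g = h * w.prod := by
  refine Nat.sInf_mem (s := {n | ∃ w : List G, w.length = n ∧ (∀ s ∈ w, s ∈ S.carrier) ∧
    g = h * w.prod}) ?_
  have hm : h⁻¹ * g ∈ Subgroup.closure S.carrier := by rw [S.closure_eq]; trivial
  rw [← Subgroup.mem_toSubmonoid, Subgroup.closure_toSubmonoid] at hm
  obtain ⟨w, hw, e⟩ := Submonoid.exists_list_of_mem_closure hm
  refine ⟨w.length, w, rfl, fun s hs => ?_, by rw [e]; group⟩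
  rcases hw s hs with h1 | h1
  · exact h1
  · simpa using S.inv_mem _ h1

theorem wordDist_self (g : G) : wordDist S g g = 0 :=
  Nat.le_zero.1 (wordDist_le S g g [] (by simp) (by simp))

theorem wordDist_comm_le (g h : G) : wordDist S g h ≤ wordDist S h g := by
  obtain ⟨w, hl, hw, e⟩ := exists_word S h g
  rw [← hl]
  have h1 := wordDist_le S g h (w.map (fun s => s⁻¹)).reverse
    (by
      intro s hs
      simp only [List.mem_reverse, List.mem_map] at hs
      obtain ⟨t, ht, rfl⟩ := hs
      exact S.inv_mem t (hw t ht))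
    (by rw [← List.prod_inv_reverse, e]; group)
  simpa using h1

theorem wordDist_triangle (a b c : G) : wordDist S a c ≤ wordDist S a b + wordDist S b c := by
  obtain ⟨v, hlv, hv, ev⟩ := exists_word S a b
  obtain ⟨w, hlw, hw, ew⟩ := exists_word S b c
  have h := wordDist_le S a c (w ++ v)
    (by
      intro s hs
      rcases List.mem_append.1 hs with h1 | h1
      · exact hw s h1
      · exact hv s h1)
    (by rw [List.prod_append, ← mul_assoc, ← ew, ← ev])
  rw [List.length_append] at h
  omega

theorem eq_of_wordDist_eq_zero {g h : G} (e : wordDist S g h = 0) : g = h := by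
  obtain ⟨w, hl, -, e'⟩ := exists_word S g h
  rw [e, List.length_eq_zero_iff] at hl
  simpa [hl] using e'

end wordDist

/-- The word metric of `S` on `G`. -/
abbrev wordMetricSpace {G : Type*} [Group G] (S : SymmGenSet G) : MetricSpace G where
  dist g h := (wordDist S g h : ℝ)
  dist_self g := by exact_mod_cast wordDist_self S g
  dist_comm g h := by
    exact_mod_cast le_antisymm (wordDist_comm_le S g h) (wordDist_comm_le S h g)
  dist_triangle a b c := by exact_mod_cast wordDist_triangle S a b c
  eq_of_dist_eq_zero {g h} e := eq_of_wordDist_eq_zero S (by exact_mod_cast e)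

/-- The group `G` regarded as a metric space with the word metric of `S`. -/
def WordSpace {G : Type*} [Group G] (_S : SymmGenSet G) : Type _ := G

instance {G : Type*} [Group G] (S : SymmGenSet G) : MetricSpace (WordSpace S) :=
  wordMetricSpace (G := G) S

/-! ### Geodesic spaces, nets and group actions -/

/-- Any two points are joined by an isometric copy of the interval `[0, dist x y]`. -/
def IsGeodesicSpace (X : Type*) [MetricSpace X] : Prop :=
  ∀ x y : X, ∃ γ : ℝ → X, γ 0 = x ∧ γ (dist x y) = y ∧
    ∀ s ∈ Set.Icc 0 (dist x y), ∀ t ∈ Set.Icc 0 (dist x y), dist (γ s) (γ t) = |s - t|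

/-- A net in `X`: a uniformly separated subset from which all points of `X` have bounded
distance. -/
def IsNetIn {X : Type*} [MetricSpace X] (N : Set X) : Prop :=
  (∃ a : ℝ, 0 < a ∧ ∀ x ∈ N, ∀ y ∈ N, x ≠ y → a ≤ dist x y) ∧
    ∃ b : ℝ, 0 < b ∧ ∀ x : X, ∃ y ∈ N, dist x y ≤ b

/-- No element other than the identity fixes a point. -/
def IsFreeAction (G X : Type*) [Group G] [MulAction G X] : Prop :=
  ∀ (g : G) (x : X), g • x = x → g = 1

/-- The translates of some compact set cover `X`. -/
def IsCocompactAction (G X : Type*) [Group G] [TopologicalSpace X] [MulAction G X] : Prop :=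
  ∃ K : Set X, IsCompact K ∧ ⋃ g : G, (fun x : X => g • x) '' K = Set.univ

end

noncomputable section

/-! If `G` is finite, any bijection between `N` and `G` is bi-Lipschitz, which settles that case. If
`G` is infinite, the Švarc–Milnor estimates make `N` and `G` coarsely equivalent, but a coarse
equivalence need not be a bijection, so the free spaces cannot be compared directly. The remedy is
to glue the two spaces along the coarse equivalence. Hanging the points of either space on the other
describes the free space of the union in two ways, so 𝓕(M) ⊕ ℓ₁(N) ≅ 𝓕(N) ⊕ ℓ₁(M)
(`nonempty_prod_freeL1_equiv`). The ℓ₁ summands are then absorbed: an unbounded space carries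
disjointly supported bumps whose peaks escape to infinity, so its free space has a complemented ℓ₁,
and ℓ₁ ≅ ℓ₁ ⊕ ℓ₁ gives 𝓕(M) ≅ 𝓕(M) ⊕ ℓ₁ (`nonempty_equiv_prod_freeL1`). All operators come from the
universal property `lift`, and identities between them are checked on the points δ(x). -/

/-- The space `𝓕(M)` as a type of its own, so that its instances are found through its norm. -/
def FreeSpace (M : Type*) [MetricSpace M] (o : M) : Type _ := LipschitzFree M o

namespace FreeSpace

variable {M : Type*} [MetricSpace M] {o : M}

instance : NormedAddCommGroup (FreeSpace M o) :=
  inferInstanceAs (NormedAddCommGroup (LipschitzFree M o))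

instance : NormedSpace ℝ (FreeSpace M o) := inferInstanceAs (NormedSpace ℝ (LipschitzFree M o))

instance : CompleteSpace (FreeSpace M o) :=
  (Submodule.isClosed_topologicalClosure
    (Submodule.span ℝ (Set.range (LipZero.eval o)))).completeSpace_coe

/-- The identification with the subspace of the dual of `Lip₀(M)`. -/
def equivLipschitzFree (M : Type*) [MetricSpace M] (o : M) :
    FreeSpace M o ≃L[ℝ] LipschitzFree M o :=
  ContinuousLinearEquiv.refl ℝ (LipschitzFree M o)

/-- The inclusion in the dual of `Lip₀(M)`. -/
def toDual (M : Type*) [MetricSpace M] (o : M) :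
    FreeSpace M o →L[ℝ] StrongDual ℝ (LipZero M o) :=
  Submodule.subtypeL (Submodule.span ℝ (Set.range (LipZero.eval o))).topologicalClosure

/-- The canonical embedding of `M` into its Lipschitz-free space. -/
def delta (o x : M) : FreeSpace M o :=
  (⟨LipZero.eval o x, Submodule.le_topologicalClosure _ (Submodule.subset_span ⟨x, rfl⟩)⟩ :
    LipschitzFree M o)

theorem delta_base : delta o o = 0 :=
  Subtype.ext (ContinuousLinearMap.ext fun f => LipZero.apply_base f)

theorem norm_delta_sub_delta_le (x y : M) : ‖delta o x - delta o y‖ ≤ dist x y := by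
  change ‖LipZero.eval o x - LipZero.eval o y‖ ≤ dist x y
  refine ContinuousLinearMap.opNorm_le_bound _ dist_nonneg fun f => ?_
  rw [mul_comm]
  exact LipZero.abs_sub_le f x y

theorem lipschitzWith_delta : LipschitzWith 1 (delta o) :=
  LipschitzWith.of_dist_le_mul fun x y => by
    rw [dist_eq_norm, NNReal.coe_one, one_mul]
    exact norm_delta_sub_delta_le x y

theorem dense_span_range_delta :
    Dense (Submodule.span ℝ (Set.range (delta o)) : Set (FreeSpace M o)) := by
  refine Subtype.dense_iff.2 fun μ hμ => ?_
  have h : toDual M o '' (Submodule.span ℝ (Set.range (delta o)) : Set (FreeSpace M o)) =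
      (Submodule.span ℝ (Set.range (LipZero.eval o)) : Set (StrongDual ℝ (LipZero M o))) := by
    have h1 := Submodule.map_span (toDual M o).toLinearMap (Set.range (delta o))
    rw [← Set.range_comp] at h1
    exact congrArg SetLike.coe h1
  exact (congrArg closure h).symm.subset hμ

theorem hom_ext {E : Type*} [NormedAddCommGroup E] [NormedSpace ℝ E]
    {f g : FreeSpace M o →L[ℝ] E} (h : ∀ x, f (delta o x) = g (delta o x)) : f = g :=
  ContinuousLinearMap.ext_on dense_span_range_delta (by rintro _ ⟨x, rfl⟩; exact h x)

/-! ### Universal property: linearization of Lipschitz maps into Banach spaces. -/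

section lift

variable {E : Type*} [NormedAddCommGroup E] [NormedSpace ℝ E]

/-- Composition of functionals on `E` with a Lipschitz map `M → E`, normalized at the base
point. -/
def pullback (o : M) (φ : M → E) (hφ : ∃ K, LipschitzWith K φ) :
    StrongDual ℝ E →L[ℝ] LipZero M o :=
  have key : ∀ y : StrongDual ℝ E, ∀ a b,
      |y (φ a - φ o) - y (φ b - φ o)| ≤ hφ.choose * ‖y‖ * dist a b := fun y a b => by
    rw [← map_sub, sub_sub_sub_cancel_right, ← Real.norm_eq_abs]
    refine (y.le_opNorm _).trans ?_
    rw [mul_right_comm, mul_comm, ← dist_eq_norm]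
    exact mul_le_mul_of_nonneg_right (hφ.choose_spec.dist_le_mul a b) (norm_nonneg y)
  LinearMap.mkContinuous
    { toFun := fun y => ⟨fun x => y (φ x - φ o), by simp, hφ.choose * ‖y‖, by positivity, key y⟩
      map_add' := fun _ _ => rfl
      map_smul' := fun _ _ => rfl }
    hφ.choose (fun y => LipZero.norm_le _ (by positivity) (key y))

/-- The functional on `E*` induced by an element of `𝓕(M)` and a Lipschitz map `M → E`. -/
def bidualLift (o : M) (φ : M → E) (hφ : ∃ K, LipschitzWith K φ) :
    FreeSpace M o →L[ℝ] StrongDual ℝ (StrongDual ℝ E) :=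
  ((ContinuousLinearMap.compL ℝ (StrongDual ℝ E) (LipZero M o) ℝ).flip (pullback o φ hφ)).comp
    (toDual M o)

theorem bidualLift_delta (φ : M → E) (hφ : ∃ K, LipschitzWith K φ) (x : M) :
    bidualLift o φ hφ (delta o x) =
      NormedSpace.inclusionInDoubleDualLi ℝ (φ x - φ o) := rfl

variable [CompleteSpace E]

/-- The value at δ(x) is φ(x) - φ(o), which lies in E. Completeness makes E closed in its bidual, so
density of the span of the δ(x) gives the rest. -/
theorem bidualLift_mem_range (φ : M → E) (hφ : ∃ K, LipschitzWith K φ) (μ : FreeSpace M o) :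
    bidualLift o φ hφ μ ∈
      LinearMap.range (NormedSpace.inclusionInDoubleDualLi ℝ (E := E)).toLinearMap := by
  have hcl : IsClosed (Set.range (NormedSpace.inclusionInDoubleDualLi ℝ (E := E))) := by
    have h := (NormedSpace.inclusionInDoubleDualLi ℝ (E := E)).isometry
    exact ((completeSpace_iff_isComplete_range h.isUniformInducing).1 inferInstance).isClosed
  have h : (Submodule.span ℝ (Set.range (delta o)) : Set (FreeSpace M o)) ⊆
      bidualLift o φ hφ ⁻¹' Set.range (NormedSpace.inclusionInDoubleDualLi ℝ (E := E)) := by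
    have h1 : Submodule.span ℝ (Set.range (delta o)) ≤
        (LinearMap.range (NormedSpace.inclusionInDoubleDualLi ℝ (E := E)).toLinearMap).comap
          (bidualLift o φ hφ).toLinearMap := by
      rw [Submodule.span_le]
      rintro _ ⟨x, rfl⟩
      exact ⟨φ x - φ o, rfl⟩
    exact h1
  have h2 := (hcl.preimage (bidualLift o φ hφ).continuous).closure_subset_iff.2 h
  rw [dense_span_range_delta.closure_eq] at h2
  exact h2 (Set.mem_univ μ)

/-- The linear extension of a Lipschitz map into a Banach space. -/
def lift (o : M) (φ : M → E) (hφ : ∃ K, LipschitzWith K φ) : FreeSpace M o →L[ℝ] E :=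
  ((NormedSpace.inclusionInDoubleDualLi ℝ (E := E)).equivRange.symm :
      LinearMap.range (NormedSpace.inclusionInDoubleDualLi ℝ (E := E)).toLinearMap →L[ℝ] E).comp
    ((bidualLift o φ hφ).codRestrict _ (bidualLift_mem_range φ hφ))

@[simp] theorem lift_delta (φ : M → E) (hφ : ∃ K, LipschitzWith K φ) (x : M) :
    lift o φ hφ (delta o x) = φ x - φ o := by
  change (NormedSpace.inclusionInDoubleDualLi ℝ (E := E)).equivRange.symm _ = _
  rw [LinearIsometryEquiv.symm_apply_eq]
  exact Subtype.ext (bidualLift_delta φ hφ x)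

end lift

/-- Bi-Lipschitz equivalent metric spaces have isomorphic Lipschitz-free spaces. -/
theorem nonempty_equiv_of_equiv {M N : Type*} [MetricSpace M] [MetricSpace N] (o : M) (p : N)
    (f : M ≃ N) (hf : ∃ K, LipschitzWith K f) (hf' : ∃ K, LipschitzWith K f.symm) :
    Nonempty (FreeSpace M o ≃L[ℝ] FreeSpace N p) := by
  obtain ⟨K, hK⟩ := hf
  obtain ⟨L, hL⟩ := hf'
  let A := lift o (fun x => delta p (f x)) ⟨_, lipschitzWith_delta.comp hK⟩
  let B := lift p (fun y => delta o (f.symm y)) ⟨_, lipschitzWith_delta.comp hL⟩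
  refine ⟨ContinuousLinearEquiv.equivOfInverse' A B ?_ ?_⟩ <;>
    refine hom_ext fun x => ?_ <;> simp [A, B, delta_base]

/-! ### The space `ℓ₁` as a Lipschitz-free space -/

/-- The type `ι` with a base point added, to carry the discrete metric. -/
inductive Pointed (ι : Type*)
  | base : Pointed ι
  | of (i : ι) : Pointed ι

/-- The extension of a family of vectors by `0` at the base point. -/
def Pointed.elim {ι E : Type*} [Zero E] (φ : ι → E) : Pointed ι → E
  | base => 0
  | of i => φ i

open Classical in
instance (ι : Type*) : MetricSpace (Pointed ι) where
  dist x y := if x = y then 0 else 1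
  dist_self x := if_pos rfl
  dist_comm x y := by simp only [eq_comm]
  dist_triangle x y z := by
    by_cases h : x = y
    · simp [h]
    · have : (if x = z then (0 : ℝ) else 1) ≤ 1 := by split_ifs <;> norm_num
      have : (0 : ℝ) ≤ if y = z then (0 : ℝ) else 1 := by split_ifs <;> norm_num
      rw [if_neg h]
      linarith
  eq_of_dist_eq_zero {x y} h := by
    by_contra h'
    simp [h'] at h

theorem Pointed.dist_of_ne {ι : Type*} {x y : Pointed ι} (h : x ≠ y) : dist x y = 1 := if_neg h

/-- The Banach space `ℓ₁(ι)`, realized as the Lipschitz-free space of a discrete metric space. -/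
abbrev FreeL1 (ι : Type*) : Type _ := FreeSpace (Pointed ι) Pointed.base

namespace FreeL1

variable {ι : Type*}

/-- The unit vectors of `ℓ₁(ι)`. -/
def single (i : ι) : FreeL1 ι := delta Pointed.base (Pointed.of i)

theorem norm_single_le (i : ι) : ‖single i‖ ≤ 1 := by
  have h := norm_delta_sub_delta_le (o := (Pointed.base : Pointed ι)) (Pointed.of i) Pointed.base
  rw [delta_base, sub_zero] at h
  exact h.trans (Pointed.dist_of_ne (by simp)).le

theorem hom_ext {E : Type*} [NormedAddCommGroup E] [NormedSpace ℝ E]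
    {f g : FreeL1 ι →L[ℝ] E} (h : ∀ i, f (single i) = g (single i)) : f = g := by
  refine FreeSpace.hom_ext fun x => ?_
  match x with
  | .base => rw [delta_base, map_zero, map_zero]
  | .of i => exact h i

section lift

variable {E : Type*} [NormedAddCommGroup E] [NormedSpace ℝ E] [CompleteSpace E]

-- Distinct points are at distance 1, so the diameter of the image bounds the Lipschitz constant.
-- This gives bounded families their linear extension, the universal property of ℓ₁.
omit [NormedSpace ℝ E] [CompleteSpace E] in
theorem lipschitzWith_elim (φ : ι → E) {C : ℝ} (hφ : ∀ i, ‖φ i‖ ≤ C) :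
    LipschitzWith (2 * C).toNNReal
      (Pointed.elim φ) := by
  refine LipschitzWith.of_dist_le_mul fun x y => ?_
  rcases eq_or_ne x y with rfl | h
  · simp
  · rw [Pointed.dist_of_ne h, mul_one, dist_eq_norm]
    refine le_trans ?_ (Real.le_coe_toNNReal _)
    match x, y with
    | .base, .base => exact absurd rfl h
    | .base, .of j =>
      have h1 := norm_nonneg (φ j)
      have h2 := hφ j
      simp only [Pointed.elim, zero_sub, norm_neg]
      linarith
    | .of j, .base =>
      have h1 := norm_nonneg (φ j)
      have h2 := hφ j
      simp only [Pointed.elim, sub_zero]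
      linarith
    | .of i, .of j =>
      simp only [Pointed.elim]
      exact (norm_sub_le _ _).trans (by linarith [hφ i, hφ j])

/-- The linear extension of a bounded family of vectors. -/
def lift (φ : ι → E) (hφ : ∃ C, ∀ i, ‖φ i‖ ≤ C) : FreeL1 ι →L[ℝ] E :=
  FreeSpace.lift _ _ ⟨_, lipschitzWith_elim φ hφ.choose_spec⟩

@[simp] theorem lift_single (φ : ι → E) (hφ : ∃ C, ∀ i, ‖φ i‖ ≤ C) (i : ι) :
    lift φ hφ (single i) = φ i :=
  (FreeSpace.lift_delta _ _ _).trans (sub_zero _)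

end lift

/-- A bijection of index sets induces an isomorphism. -/
theorem nonempty_congr {κ : Type*} (f : ι ≃ κ) : Nonempty (FreeL1 ι ≃L[ℝ] FreeL1 κ) := by
  let A : FreeL1 ι →L[ℝ] FreeL1 κ := lift (fun i => single (f i)) ⟨1, fun _ => norm_single_le _⟩
  let B : FreeL1 κ →L[ℝ] FreeL1 ι :=
    lift (fun i => single (f.symm i)) ⟨1, fun _ => norm_single_le _⟩
  refine ⟨ContinuousLinearEquiv.equivOfInverse' A B ?_ ?_⟩ <;>
    refine hom_ext fun x => ?_ <;> simp [A, B]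

theorem nonempty_sum (ι κ : Type*) : Nonempty (FreeL1 (ι ⊕ κ) ≃L[ℝ] FreeL1 ι × FreeL1 κ) := by
  let A : FreeL1 (ι ⊕ κ) →L[ℝ] FreeL1 ι × FreeL1 κ :=
    lift (Sum.elim (fun i => (single i, 0)) (fun j => (0, single j))) ⟨1, by
      rintro (i | j)
      · simpa [Prod.norm_def] using norm_single_le i
      · simpa [Prod.norm_def] using norm_single_le j⟩
  let B₁ : FreeL1 ι →L[ℝ] FreeL1 (ι ⊕ κ) :=
    lift (fun i => single (Sum.inl i)) ⟨1, fun _ => norm_single_le _⟩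
  let B₂ : FreeL1 κ →L[ℝ] FreeL1 (ι ⊕ κ) :=
    lift (fun j => single (Sum.inr j)) ⟨1, fun _ => norm_single_le _⟩
  refine ⟨ContinuousLinearEquiv.equivOfInverse' A (B₁.coprod B₂) ?_ ?_⟩
  · refine ContinuousLinearMap.prod_ext (hom_ext fun i => ?_) (hom_ext fun j => ?_)
    · simp [A, B₁]
    · simp [A, B₂]
  · refine hom_ext ?_
    rintro (i | j)
    · simp [A, B₁]
    · simp [A, B₂]

theorem nonempty_prod_self : Nonempty (FreeL1 ℕ ≃L[ℝ] FreeL1 ℕ × FreeL1 ℕ) := by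
  obtain ⟨a⟩ := nonempty_congr Equiv.natSumNatEquivNat.symm
  obtain ⟨b⟩ := nonempty_sum ℕ ℕ
  exact ⟨a.trans b⟩

end FreeL1

end FreeSpace

namespace FreeSpace

/-! ### Coarse equivalences -/

section Coarse

variable {M N : Type*} [MetricSpace M] [MetricSpace N]

/-- Two unit vectors differ by at most 2 in norm, while distinct points are at least `a` apart.
Hence x ↦ e_x extends linearly to the free space. -/
theorem lipschitzWith_single {a : ℝ} (ha : 0 < a) (hM : ∀ x y : M, x ≠ y → a ≤ dist x y) :
    LipschitzWith (2 / a).toNNReal (FreeL1.single : M → FreeL1 M) := by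
  refine LipschitzWith.of_dist_le_mul fun x y => ?_
  rcases eq_or_ne x y with rfl | h
  · simp
  · rw [Real.coe_toNNReal _ (by positivity), dist_eq_norm]
    calc _ ≤ ‖FreeL1.single x‖ + ‖FreeL1.single y‖ := norm_sub_le _ _
      _ ≤ 2 := by linarith [FreeL1.norm_single_le x, FreeL1.norm_single_le y]
      _ = 2 / a * a := by field_simp
      _ ≤ _ := by gcongr; exact hM x y h

/-- The comparison map of a coarse equivalence `f` with coarse inverse `g`. -/
def coarseMap (o : M) (p : N) (f : M → N) (g : N → M) (hf : ∃ K, LipschitzWith K f)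
    (hfg : ∃ C, ∀ y, dist y (f (g y)) ≤ C)
    (hs : ∃ K, LipschitzWith K (FreeL1.single : M → FreeL1 M)) :
    FreeSpace M o × FreeL1 N →L[ℝ] FreeSpace N p × FreeL1 M :=
  -- In the free space of the union of M and N, let e_y stand for δ(y) - δ(g y) and e_x for δ(x) -
  -- δ(f x). Then δ(x) = δ(f x) + e_x and e_y = δ(y) - δ(f(g y)) - e_{g y}; these two formulas,
  -- normalized at the base point, are the map. The second is bounded because f ∘ g is close to the
  -- identity.
  ((lift o (fun x => delta p (f x)) ⟨_, lipschitzWith_delta.comp hf.choose_spec⟩).prod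
    (lift o FreeL1.single hs)).coprod
  ((FreeL1.lift (fun y => delta p y - delta p (f (g y)))
      ⟨hfg.choose, fun y => (norm_delta_sub_delta_le _ _).trans (hfg.choose_spec y)⟩).prod
    (FreeL1.lift (fun y => -FreeL1.single (g y))
      ⟨1, fun _ => (norm_neg _).trans_le (FreeL1.norm_single_le _)⟩))

theorem coarseMap_comp_coarseMap (o : M) (p : N) (f : M → N) (g : N → M)
    (hf : ∃ K, LipschitzWith K f) (hg : ∃ K, LipschitzWith K g)
    (hfg : ∃ C, ∀ y, dist y (f (g y)) ≤ C) (hgf : ∃ C, ∀ x, dist x (g (f x)) ≤ C)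
    (hM : ∃ K, LipschitzWith K (FreeL1.single : M → FreeL1 M))
    (hN : ∃ K, LipschitzWith K (FreeL1.single : N → FreeL1 N)) :
    (coarseMap p o g f hg hgf hN).comp (coarseMap o p f g hf hfg hM) =
      ContinuousLinearMap.id ℝ _ := by
  refine ContinuousLinearMap.prod_ext (hom_ext fun x => ?_) (FreeL1.hom_ext fun y => ?_)
  · refine Prod.ext ?_ ?_ <;> simp [coarseMap, delta_base]
  · refine Prod.ext ?_ ?_ <;> simp [coarseMap]

/-- Coarsely equivalent uniformly discrete spaces have Lipschitz-free spaces that are isomorphic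
after adding `ℓ₁` summands. -/
theorem nonempty_prod_freeL1_equiv (o : M) (p : N) (f : M → N) (g : N → M)
    (hf : ∃ K, LipschitzWith K f) (hg : ∃ K, LipschitzWith K g)
    (hfg : ∃ C, ∀ y, dist y (f (g y)) ≤ C) (hgf : ∃ C, ∀ x, dist x (g (f x)) ≤ C)
    (hM : ∃ a > 0, ∀ x y : M, x ≠ y → a ≤ dist x y)
    (hN : ∃ a > 0, ∀ x y : N, x ≠ y → a ≤ dist x y) :
    Nonempty ((FreeSpace M o × FreeL1 N) ≃L[ℝ] (FreeSpace N p × FreeL1 M)) := by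
  obtain ⟨a, ha, hM⟩ := hM
  obtain ⟨b, hb, hN⟩ := hN
  exact ⟨ContinuousLinearEquiv.equivOfInverse'
    (coarseMap o p f g hf hfg ⟨_, lipschitzWith_single ha hM⟩)
    (coarseMap p o g f hg hgf ⟨_, lipschitzWith_single hb hN⟩)
    (coarseMap_comp_coarseMap p o g f hg hf hgf hfg _ _)
    (coarseMap_comp_coarseMap o p f g hf hg hfg hgf _ _)⟩

end Coarse

/-! ### Unbounded spaces -/

section Unbounded

variable {M : Type*} [MetricSpace M] {o : M}

theorem exists_seq_three_mul_dist_lt (h : ∀ r : ℝ, ∃ x : M, r < dist x o) :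
    ∃ u : ℕ → M, (∀ n, 0 < dist (u n) o) ∧ ∀ m n, m < n → 3 * dist (u m) o < dist (u n) o := by
  choose F hF using h
  let u : ℕ → M := fun n => Nat.rec (F 0) (fun _ x => F (3 * dist x o)) n
  have hu : ∀ n, 3 * dist (u n) o < dist (u (n + 1)) o := fun n => hF _
  have h0 : ∀ n, 0 < dist (u n) o := by
    intro n
    induction n with
    | zero => exact hF 0
    | succ n ih => linarith [hu n]
  have hmono : StrictMono fun n => dist (u n) o :=
    strictMono_nat_of_lt_succ fun n => by linarith [hu n, h0 n]
  exact ⟨u, h0, fun m n hmn => (hu m).trans_le (hmono.monotone hmn)⟩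

/-- The bump of height `dist z o / 2` around the point `z`. -/
def bump (o z x : M) : ℝ := max 0 (dist z o / 2 - dist x z)

theorem bump_self (z : M) : bump o z z = dist z o / 2 := by
  rw [bump, dist_self, sub_zero, max_eq_right (by positivity)]

theorem bump_base (z : M) : bump o z o = 0 := by
  rw [bump, dist_comm o z]
  exact max_eq_left (by linarith [dist_nonneg (x := z) (y := o)])

theorem abs_bump_sub_bump_le (z x y : M) : |bump o z x - bump o z y| ≤ dist x y := by
  refine (abs_max_sub_max_le_max _ _ _ _).trans ?_
  rw [sub_self, abs_zero, sub_sub_sub_cancel_left, abs_sub_comm]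
  exact max_le dist_nonneg (abs_dist_sub_le x y z)

/-- A bump around z is nonzero at x only if d(x, o) lies strictly between d(z, o)/2 and 3d(z, o)/2.
Since the distances d(u n, o) grow by more than a factor 3, these intervals are disjoint. -/
theorem exists_bump_eq_zero {u : ℕ → M}
    (hu : ∀ m n, m < n → 3 * dist (u m) o < dist (u n) o) (x : M) :
    ∃ n, ∀ m, m ≠ n → bump o (u m) x = 0 := by
  by_cases h : ∃ n, bump o (u n) x ≠ 0
  · obtain ⟨n, hn⟩ := h
    have key : ∀ k, bump o (u k) x ≠ 0 →
        dist (u k) o / 2 < dist x o ∧ dist x o < 3 * dist (u k) o / 2 := by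
      intro k hk
      have h1 : dist x (u k) < dist (u k) o / 2 := by
        by_contra! h1
        exact hk (max_eq_left (by linarith))
      have h2 := dist_triangle x (u k) o
      have h3 := dist_triangle_left (u k) o x
      constructor <;> linarith
    refine ⟨n, fun m hmn => ?_⟩
    by_contra hm
    have h1 := key n hn
    have h2 := key m hm
    rcases lt_or_gt_of_ne hmn with h3 | h3
    · linarith [hu m n h3]
    · linarith [hu n m h3]
  · push Not at h
    exact ⟨0, fun m _ => h m⟩

/-- The Lipschitz-free space of an unbounded space contains a complemented copy of `ℓ₁`. -/
theorem exists_freeL1_retract (h : ∀ r : ℝ, ∃ x : M, r < dist x o) :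
    ∃ (T : FreeSpace M o →L[ℝ] FreeL1 ℕ) (J : FreeL1 ℕ →L[ℝ] FreeSpace M o),
      Function.RightInverse J T := by
  obtain ⟨u, hu0, hu⟩ := exists_seq_three_mul_dist_lt h
  choose ν hν using exists_bump_eq_zero (o := o) hu
  have hφ : ∀ n x, ν x = n ∨ bump o (u n) x = 0 := fun n x => by
    by_cases hn : n = ν x
    · exact Or.inl hn.symm
    · exact Or.inr (hν x n hn)
  -- The coordinates of φ are all the bumps at once; at x only the one of index ν x can be nonzero.
  let φ : M → FreeL1 ℕ := fun x => bump o (u (ν x)) x • FreeL1.single (ν x)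
  have hnorm : ∀ (c : ℝ) n, ‖c • (FreeL1.single n : FreeL1 ℕ)‖ ≤ |c| := fun c n => by
    rw [norm_smul, Real.norm_eq_abs]
    exact mul_le_of_le_one_right (abs_nonneg c) (FreeL1.norm_single_le n)
  have hLip : LipschitzWith 2 φ := by
    refine LipschitzWith.of_dist_le_mul fun x y => ?_
    rw [dist_eq_norm, NNReal.coe_ofNat]
    by_cases hxy : ν x = ν y
    · have h1 : φ x - φ y = (bump o (u (ν y)) x - bump o (u (ν y)) y) • FreeL1.single (ν y) := by
        simp only [φ, hxy, sub_smul]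
      rw [h1]
      have := abs_bump_sub_bump_le (o := o) (u (ν y)) x y
      linarith [hnorm (bump o (u (ν y)) x - bump o (u (ν y)) y) (ν y),
        dist_nonneg (x := x) (y := y)]
    -- With different indices, each bump vanishes at the other point, so each of the two values is
    -- at most d(x, y). Their sum accounts for the constant 2.
    · have h1 := abs_bump_sub_bump_le (o := o) (u (ν x)) x y
      have h2 := abs_bump_sub_bump_le (o := o) (u (ν y)) x y
      rw [hν y _ hxy, sub_zero] at h1
      rw [hν x _ (Ne.symm hxy), zero_sub, abs_neg] at h2
      have h3 := hnorm (bump o (u (ν x)) x) (ν x)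
      have h4 := hnorm (bump o (u (ν y)) y) (ν y)
      have h5 := norm_sub_le (φ x) (φ y)
      linarith
  have hφu : ∀ n, φ (u n) = (dist (u n) o / 2) • FreeL1.single n := fun n => by
    rcases hφ n (u n) with h1 | h1
    · simp only [φ, h1, bump_self]
    · rw [bump_self] at h1
      linarith [hu0 n]
  have hφo : φ o = 0 := by simp only [φ, bump_base, zero_smul]
  let T : FreeSpace M o →L[ℝ] FreeL1 ℕ := lift o φ ⟨2, hLip⟩
  -- The factor is the reciprocal of the bump height, so T ∘ J fixes each unit vector; the images
  -- have norm at most 2.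
  let J : FreeL1 ℕ →L[ℝ] FreeSpace M o :=
    FreeL1.lift (fun n => (2 / dist (u n) o) • delta o (u n)) ⟨2, fun n => by
      have h1 := norm_delta_sub_delta_le (o := o) (u n) o
      rw [delta_base, sub_zero] at h1
      have h0 := hu0 n
      rw [norm_smul, Real.norm_of_nonneg (by positivity)]
      calc _ ≤ 2 / dist (u n) o * dist (u n) o := by gcongr
        _ = 2 := by field_simp⟩
  have hTJ : T.comp J = ContinuousLinearMap.id ℝ _ := by
    refine FreeL1.hom_ext fun n => ?_
    have h0 := (hu0 n).ne'
    simp only [T, J, ContinuousLinearMap.comp_apply, FreeL1.lift_single, map_smul, lift_delta,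
      hφu, hφo, sub_zero, smul_smul, ContinuousLinearMap.id_apply]
    rw [div_mul_div_cancel₀ h0, div_self two_ne_zero, one_smul]
  exact ⟨T, J, fun v => congrArg (fun F => F v) hTJ⟩

/-- The Lipschitz-free space of an unbounded space absorbs an `ℓ₁` summand. -/
theorem nonempty_equiv_prod_freeL1 (h : ∀ r : ℝ, ∃ x : M, r < dist x o) (ι : Type*)
    [Countable ι] [Infinite ι] :
    Nonempty (FreeSpace M o ≃L[ℝ] FreeSpace M o × FreeL1 ι) := by
  obtain ⟨T, J, hTJ⟩ := exists_freeL1_retract h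
  obtain ⟨d⟩ := FreeL1.nonempty_prod_self
  obtain ⟨_⟩ := nonempty_denumerable ι
  obtain ⟨c⟩ := FreeL1.nonempty_congr (Denumerable.eqv ι).symm
  let a := ContinuousLinearEquiv.equivOfRightInverse T J hTJ
  -- Write 𝓕(M) as ℓ₁ ⊕ ker T, split ℓ₁ into two copies, and recombine one of them with ker T.
  exact ⟨a.trans <| (d.prodCongr (.refl ℝ _)).trans <|
    (ContinuousLinearEquiv.prodAssoc ℝ _ _ _).trans <|
    (ContinuousLinearEquiv.prodComm ℝ _ _).trans <| a.symm.prodCongr c⟩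

/-- Coarsely equivalent, uniformly discrete, unbounded countable spaces have isomorphic
Lipschitz-free spaces. -/
theorem nonempty_equiv_of_coarse {N : Type*} [MetricSpace N] (p : N) (f : M → N) (g : N → M)
    (hf : ∃ K, LipschitzWith K f) (hg : ∃ K, LipschitzWith K g)
    (hfg : ∃ C, ∀ y, dist y (f (g y)) ≤ C) (hgf : ∃ C, ∀ x, dist x (g (f x)) ≤ C)
    (hM : ∃ a > 0, ∀ x y : M, x ≠ y → a ≤ dist x y)
    (hN : ∃ a > 0, ∀ x y : N, x ≠ y → a ≤ dist x y)
    (huM : ∀ r : ℝ, ∃ x : M, r < dist x o) (huN : ∀ r : ℝ, ∃ y : N, r < dist y p)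
    [Countable M] [Infinite M] [Countable N] [Infinite N] :
    Nonempty (FreeSpace M o ≃L[ℝ] FreeSpace N p) := by
  -- The index sets are crossed, so that the absorbed summands are those of the coarse isomorphism.
  obtain ⟨a⟩ := nonempty_equiv_prod_freeL1 huM N
  obtain ⟨b⟩ := nonempty_equiv_prod_freeL1 huN M
  obtain ⟨c⟩ := nonempty_prod_freeL1_equiv o p f g hf hg hfg hgf hM hN
  exact ⟨(a.trans c).trans b.symm⟩

end Unbounded

end FreeSpace

/-! ### Lipschitz maps on uniformly discrete spaces -/

/-- On a uniformly discrete space distinct points satisfy 1 ≤ d(x, y)/a, so the additive error is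
absorbed into the multiplicative constant. -/
theorem exists_lipschitzWith_of_dist_le {M N : Type*} [MetricSpace M] [MetricSpace N]
    (hM : ∃ a > 0, ∀ x y : M, x ≠ y → a ≤ dist x y) {f : M → N} {C : ℝ}
    (h : ∀ x y, dist (f x) (f y) ≤ C * (dist x y + 1)) : ∃ K, LipschitzWith K f := by
  obtain ⟨a, ha, hM⟩ := hM
  refine ⟨(C * (1 + 1 / a)).toNNReal, LipschitzWith.of_dist_le_mul fun x y => ?_⟩
  rcases eq_or_ne x y with rfl | hxy
  · simp
  · have hC : 0 ≤ C := nonneg_of_mul_nonneg_left (dist_nonneg.trans (h x y)) (by positivity)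
    have h1 : 1 ≤ 1 / a * dist x y := by
      rw [one_div, inv_mul_eq_div, one_le_div ha]
      exact hM x y hxy
    calc _ ≤ C * (dist x y + 1) := h x y
      _ ≤ C * (dist x y + 1 / a * dist x y) := by gcongr
      _ = C * (1 + 1 / a) * dist x y := by ring
      _ ≤ _ := mul_le_mul_of_nonneg_right (Real.le_coe_toNNReal _) dist_nonneg

theorem exists_lipschitzWith_of_finite {M N : Type*} [MetricSpace M] [MetricSpace N] [Finite M]
    (hM : ∃ a > 0, ∀ x y : M, x ≠ y → a ≤ dist x y) (f : M → N) : ∃ K, LipschitzWith K f := by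
  obtain ⟨C, hC⟩ := (Set.finite_range fun p : M × M => dist (f p.1) (f p.2)).bddAbove
  have h : ∀ x y, dist (f x) (f y) ≤ C := fun x y => hC ⟨(x, y), rfl⟩
  refine exists_lipschitzWith_of_dist_le hM (C := C) fun x y => (h x y).trans ?_
  exact le_mul_of_one_le_right (dist_nonneg.trans (h x y)) 
    (by linarith [dist_nonneg (x := x) (y := y)])

/-! ### Geometry of proper cocompact actions -/

section Action

variable {G : Type*} [Group G] {X : Type*} [MetricSpace X] [MulAction G X]

theorem exists_dist_smul_le [IsIsometricSMul G X] (h : IsCocompactAction G X) (z : X) :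
    ∃ R : ℝ, ∀ x : X, ∃ g : G, dist x (g • z) ≤ R := by
  obtain ⟨K, hK, hcover⟩ := h
  obtain ⟨R, hR⟩ := hK.isBounded.subset_closedBall z
  refine ⟨R, fun x => ?_⟩
  obtain ⟨g, k, hk, rfl⟩ := Set.mem_iUnion.1 (hcover.symm.subset (Set.mem_univ x))
  exact ⟨g, (dist_smul g k z).trans_le (hR hk)⟩

theorem finite_setOf_dist_smul_le [ProperSpace X] [ProperlyDiscontinuousSMul G X] (z w : X)
    (r : ℝ) : {g : G | dist (g • z) w ≤ r}.Finite := by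
  refine (ProperlyDiscontinuousSMul.finite_disjoint_inter_image (Γ := G)
    (isCompact_singleton (x := z)) (isCompact_closedBall w r)).subset fun g hg => ?_
  exact ⟨g • z, ⟨z, rfl, rfl⟩, hg⟩

theorem exists_lt_dist_smul [ProperSpace X] [ProperlyDiscontinuousSMul G X] [Infinite G] (z w : X)
    (r : ℝ) : ∃ g : G, r < dist (g • z) w := by
  by_contra! h
  exact Set.infinite_univ ((finite_setOf_dist_smul_le (G := G) z w r).subset fun g _ => h g)

theorem wordDist_le_wordDist_one (S : SymmGenSet G) (g h : G) :
    wordDist S g h ≤ wordDist S (h⁻¹ * g) 1 := by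
  obtain ⟨w, hl, hw, e⟩ := exists_word S (h⁻¹ * g) 1
  rw [← hl]
  refine wordDist_le S g h w hw ?_
  rw [← one_mul w.prod, ← e, mul_inv_cancel_left]

/-- Translating by h⁻¹ reduces to moving z by a word. Each letter moves z by a bounded amount, and
the prefixes act by isometries. -/
theorem exists_dist_smul_le_mul_wordDist [IsIsometricSMul G X] (S : SymmGenSet G) (z : X) :
    ∃ L : ℝ, 0 ≤ L ∧ ∀ g h : G, dist (g • z) (h • z) ≤ L * wordDist S g h := by
  obtain ⟨L, hL⟩ := (S.finite.image fun s => dist (s • z) z).bddAbove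
  -- The generating set may be empty, in which case the upper bound `L` could be negative.
  have hL' : ∀ s ∈ S.carrier, dist (s • z) z ≤ max L 0 := fun s hs =>
    (hL ⟨s, hs, rfl⟩).trans (le_max_left _ _)
  have key : ∀ w : List G, (∀ s ∈ w, s ∈ S.carrier) →
      dist (w.prod • z) z ≤ max L 0 * w.length := by
    intro w
    induction w with
    | nil => simp
    | cons s w ih =>
      intro hw
      have h1 := hL' s (hw s List.mem_cons_self)
      have h2 := ih fun t ht => hw t (List.mem_cons_of_mem s ht)
      have h3 := dist_triangle (s • w.prod • z) (s • z) z
      rw [dist_smul] at h3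
      rw [List.prod_cons, mul_smul, List.length_cons]
      push_cast
      linarith
  refine ⟨max L 0, le_max_right _ _, fun g h => ?_⟩
  obtain ⟨w, hl, hw, rfl⟩ := exists_word S g h
  rw [← hl, mul_smul, dist_smul]
  exact key w hw

theorem IsGeodesicSpace.exists_dist_le (hX : IsGeodesicSpace X) {x y : X} {k : ℝ} (hk : 0 ≤ k)
    (h : dist x y ≤ k + 1) : ∃ p, dist p x ≤ 1 ∧ dist p y ≤ k := by
  obtain ⟨γ, h0, h1, hγ⟩ := hX x y
  have hd : (0 : ℝ) ≤ dist x y := dist_nonneg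
  have hm : min 1 (dist x y) ∈ Set.Icc 0 (dist x y) :=
    ⟨le_min zero_le_one hd, min_le_right _ _⟩
  have e0 := hγ _ hm 0 ⟨le_rfl, hd⟩
  have e1 := hγ _ hm (dist x y) ⟨hd, le_rfl⟩
  rw [h0, sub_zero, abs_of_nonneg hm.1] at e0
  rw [h1, abs_sub_comm, abs_of_nonneg (sub_nonneg.2 hm.2)] at e1
  refine ⟨γ (min 1 (dist x y)), e0.trans_le (min_le_left _ _), e1.trans_le ?_⟩
  rcases min_cases 1 (dist x y) with h2 | h2 <;> linarith

/-- The lower bound in the Švarc–Milnor lemma. -/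
theorem exists_wordDist_le [ProperSpace X] [IsIsometricSMul G X] [ProperlyDiscontinuousSMul G X]
    (hX : IsGeodesicSpace X) (hc : IsCocompactAction G X) (S : SymmGenSet G) (z : X) :
    ∃ C : ℝ, 0 ≤ C ∧ ∀ g h : G, (wordDist S g h : ℝ) ≤ C * (dist (g • z) (h • z) + 2) := by
  obtain ⟨R, hR⟩ := exists_dist_smul_le (G := G) hc z
  have hR0 : 0 ≤ R := by
    obtain ⟨g, hg⟩ := hR z
    exact dist_nonneg.trans hg
  obtain ⟨C, hC⟩ := ((finite_setOf_dist_smul_le (G := G) z z (2 * R + 1)).image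
    fun g => wordDist S g 1).bddAbove
  -- After translation by h⁻¹ only finitely many group elements are involved, by proper
  -- discontinuity; C bounds their word lengths.
  have hstep : ∀ g h : G, dist (g • z) (h • z) ≤ 2 * R + 1 → wordDist S g h ≤ C := by
    intro g h hgh
    refine (wordDist_le_wordDist_one S g h).trans (hC ⟨h⁻¹ * g, ?_, rfl⟩)
    rw [Set.mem_ofPred_eq, ← dist_smul h, smul_smul, mul_inv_cancel_left]
    exact hgh
  -- Walk from x to h • z along geodesics in steps of length at most 1, keeping an orbit point
  -- within R of the current position. Consecutive orbit points are at most R + 1 + R apart, so each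
  -- step costs C.
  have key : ∀ (k : ℕ) (x : X) (g h : G), dist x (h • z) ≤ k → dist x (g • z) ≤ R →
      wordDist S g h ≤ C * (k + 1) := by
    intro k
    induction k with
    | zero =>
      intro x g h hx hg
      rw [Nat.cast_zero, dist_le_zero] at hx
      rw [hx, dist_comm] at hg
      simpa using hstep g h (by linarith)
    | succ k ih =>
      intro x g h hx hg
      obtain ⟨p, hpx, hph⟩ := hX.exists_dist_le (Nat.cast_nonneg k)
        (by exact_mod_cast hx : dist x (h • z) ≤ k + 1)
      obtain ⟨g', hg'⟩ := hR p
      have h1 := ih p g' h hph hg'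
      have h2 : wordDist S g g' ≤ C := by
        refine hstep g g' ?_
        have h3 := dist_triangle4 (g • z) x p (g' • z)
        rw [dist_comm (g • z) x, dist_comm x p] at h3
        linarith
      calc _ ≤ wordDist S g g' + wordDist S g' h := wordDist_triangle S g g' h
        _ ≤ C + C * (k + 1) := add_le_add h2 h1
        _ = _ := by ring
  refine ⟨C, Nat.cast_nonneg C, fun g h => ?_⟩
  -- Rounding the distance up costs one, and the final step of the walk another, whence the 2.
  have h1 := key ⌈dist (g • z) (h • z)⌉₊ (g • z) g h (Nat.le_ceil _) (by simpa using hR0)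
  have h2 := (Nat.ceil_lt_add_one (dist_nonneg (x := g • z) (y := h • z))).le
  calc (wordDist S g h : ℝ) ≤ C * (⌈dist (g • z) (h • z)⌉₊ + 1) := by exact_mod_cast h1
    _ ≤ C * (dist (g • z) (h • z) + 2) :=
      mul_le_mul_of_nonneg_left (by linarith) (Nat.cast_nonneg C)

end Action

/-! ### Discreteness and countability; the infinite and the finite case. -/

theorem WordSpace.one_le_dist {G : Type*} [Group G] (S : SymmGenSet G) (g h : WordSpace S)
    (hgh : g ≠ h) : 1 ≤ dist g h := by
  have h1 : wordDist S g h ≠ 0 := fun h0 => hgh (eq_of_wordDist_eq_zero (G := G) S h0)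
  have h2 : (1 : ℝ) ≤ (wordDist (G := G) S g h : ℝ) := by
    exact_mod_cast Nat.one_le_iff_ne_zero.2 h1
  exact h2

theorem SymmGenSet.countable {G : Type*} [Group G] (S : SymmGenSet G) : Countable G := by
  have := S.finite.to_subtype
  refine Function.Surjective.countable (α := List S.carrier)
    (f := fun w => (w.map Subtype.val).prod) fun g => ?_
  obtain ⟨w, -, hw, e⟩ := exists_word S g 1
  exact ⟨w.attachWith (· ∈ S.carrier) hw, by simp [e]⟩

theorem IsNetIn.exists_le_dist {X : Type*} [MetricSpace X] {N : Set X} (hN : IsNetIn N) :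
    ∃ a > 0, ∀ x y : N, x ≠ y → a ≤ dist x y := by
  obtain ⟨⟨a, ha, h⟩, -⟩ := hN
  exact ⟨a, ha, fun x y hxy => h x x.2 y y.2 (Subtype.coe_injective.ne hxy)⟩

theorem countable_of_le_dist {M : Type*} [MetricSpace M] [SecondCountableTopology M]
    (hM : ∃ a > 0, ∀ x y : M, x ≠ y → a ≤ dist x y) : Countable M := by
  obtain ⟨a, ha, hM⟩ := hM
  have : DiscreteTopology M := DiscreteTopology.of_forall_le_dist ha fun x y hxy => hM x y hxy
  exact countable_of_Lindelof_of_discrete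

theorem infinite_of_lt_dist {M : Type*} [MetricSpace M] {o : M}
    (h : ∀ r : ℝ, ∃ x : M, r < dist x o) : Infinite M := by
  by_contra hfin
  rw [not_infinite_iff_finite] at hfin
  obtain ⟨C, hC⟩ := (Set.finite_range fun x => dist x o).bddAbove
  obtain ⟨x, hx⟩ := h C
  exact hx.not_ge (hC ⟨x, rfl⟩)

theorem nonempty_equiv_of_infinite {G : Type*} [Group G] {X : Type*} [MetricSpace X]
    [ProperSpace X] (hX : IsGeodesicSpace X) [MulAction G X] [IsIsometricSMul G X]
    (hc : IsCocompactAction G X) [ProperlyDiscontinuousSMul G X] [Infinite G]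
    (S : SymmGenSet G) (N : Set X) (hN : IsNetIn N) (o : N) (e : WordSpace S) :
    Nonempty (FreeSpace N o ≃L[ℝ] FreeSpace (WordSpace S) e) := by
  have hNd := hN.exists_le_dist
  have hGd : ∃ a > 0, ∀ x y : WordSpace S, x ≠ y → a ≤ dist x y :=
    ⟨1, one_pos, WordSpace.one_le_dist S⟩
  obtain ⟨-, b, hb, hbN⟩ := hN
  -- The orbit map through the base point of the net. The coarse equivalence sends a net point to a
  -- group element with nearby orbit point, and a group element to a net point near its orbit point.
  let t : WordSpace S → X := fun γ : G => γ • (o : X)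
  obtain ⟨L, hL, hLG⟩ : ∃ L : ℝ, 0 ≤ L ∧ ∀ γ η, dist (t γ) (t η) ≤ L * dist γ η :=
    exists_dist_smul_le_mul_wordDist S (o : X)
  obtain ⟨C, hC, hCG⟩ : ∃ C : ℝ, 0 ≤ C ∧ ∀ γ η, dist γ η ≤ C * (dist (t γ) (t η) + 2) :=
    exists_wordDist_le hX hc S (o : X)
  obtain ⟨R, hR⟩ : ∃ R : ℝ, ∀ x : X, ∃ γ, dist x (t γ) ≤ R := exists_dist_smul_le hc (o : X)
  have ht : ∀ (w : X) (r : ℝ), ∃ γ, r < dist (t γ) w := exists_lt_dist_smul (G := G) (o : X)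
  choose φ hφ using hR
  choose ψ hψN hψ using hbN
  have hR0 : 0 ≤ R := dist_nonneg.trans (hφ o)
  let f : N → WordSpace S := fun x => φ x
  let g : WordSpace S → N := fun γ => ⟨ψ (t γ), hψN _⟩
  have hf : ∃ K, LipschitzWith K f := by
    refine exists_lipschitzWith_of_dist_le hNd (C := C * (2 * R + 2)) fun x y => ?_
    have h2 := dist_triangle4 (t (φ x)) x y (t (φ y))
    rw [dist_comm _ (x : X), ← Subtype.dist_eq] at h2
    have h3 : dist (t (φ x)) (t (φ y)) + 2 ≤ (2 * R + 2) * (dist x y + 1) := by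
      have h4 : (0 : ℝ) ≤ R * dist x y := mul_nonneg hR0 dist_nonneg
      have h5 := dist_nonneg (x := x) (y := y)
      linarith [hφ x, hφ y]
    calc dist (f x) (f y) ≤ C * (dist (t (φ x)) (t (φ y)) + 2) := hCG _ _
      _ ≤ C * ((2 * R + 2) * (dist x y + 1)) := by gcongr
      _ = _ := by ring
  have hg : ∃ K, LipschitzWith K g := by
    refine exists_lipschitzWith_of_dist_le hGd (C := L + 2 * b) fun γ η => ?_
    have h2 := dist_triangle4 (ψ (t γ)) (t γ) (t η) (ψ (t η))
    rw [dist_comm (ψ (t γ)) (t γ)] at h2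
    have h3 : (0 : ℝ) ≤ b * dist γ η := mul_nonneg hb.le dist_nonneg
    change dist (ψ (t γ)) (ψ (t η)) ≤ _
    linarith [hψ (t γ), hψ (t η), hLG γ η]
  have hgf : ∃ C, ∀ x, dist x (g (f x)) ≤ C :=
    ⟨R + b, fun x => (dist_triangle (x : X) (t (φ x)) (ψ (t (φ x)))).trans
      (add_le_add (hφ x) (hψ _))⟩
  have hfg : ∃ C, ∀ γ, dist γ (f (g γ)) ≤ C := by
    refine ⟨C * (b + R + 2), fun γ => (hCG _ _).trans ?_⟩
    have h2 := dist_triangle (t γ) (ψ (t γ)) (t (φ (ψ (t γ))))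
    exact mul_le_mul_of_nonneg_left
      (add_le_add_left (h2.trans (add_le_add (hψ _) (hφ _))) 2) hC
  have huN : ∀ r : ℝ, ∃ x : N, r < dist x o := by
    intro r
    obtain ⟨γ, hγ⟩ := ht o (r + b)
    refine ⟨g γ, ?_⟩
    have h1 := dist_triangle (t γ) (ψ (t γ)) o
    change r < dist (ψ (t γ)) o
    linarith [hψ (t γ)]
  have huG : ∀ r : ℝ, ∃ γ : WordSpace S, r < dist γ e := by
    intro r
    obtain ⟨γ, hγ⟩ := ht (t e) (L * r)
    -- Orbit points escape every ball, and the orbit map is `L`-Lipschitz, so the group elements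
    -- escape as well.
    exact ⟨γ, lt_of_mul_lt_mul_left (hγ.trans_le (hLG γ e)) hL⟩
  have := countable_of_le_dist hNd
  have : Countable (WordSpace S) := S.countable
  have := infinite_of_lt_dist huN
  have := infinite_of_lt_dist huG
  exact FreeSpace.nonempty_equiv_of_coarse e f g hf hg hfg hgf hNd hGd huN huG

theorem nonempty_equiv_of_finite {G : Type*} [Group G] [Finite G] {X : Type*} [MetricSpace X]
    (S : SymmGenSet G) (N : Set X) (hN : IsNetIn N) (hcard : Nat.card N = Nat.card G)
    (o : N) (e : WordSpace S) :
    Nonempty (FreeSpace N o ≃L[ℝ] FreeSpace (WordSpace S) e) := by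
  have : Finite (WordSpace S) := ‹Finite G›
  -- `Nat.card` is 0 on infinite types, so the equality with the positive cardinality of `G` forces
  -- finiteness.
  have : Finite N := Nat.finite_of_card_ne_zero (hcard ▸ Nat.card_pos.ne')
  let f : N ≃ WordSpace S := (Finite.card_eq.1 hcard).some
  exact FreeSpace.nonempty_equiv_of_equiv o e f
    (exists_lipschitzWith_of_finite hN.exists_le_dist f)
    (exists_lipschitzWith_of_finite ⟨1, one_pos, WordSpace.one_le_dist S⟩ f.symm)

end

theorem mainTheorem8 {G : Type*} [Group G] {X : Type*} [MetricSpace X] [ProperSpace X]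
    (hX : IsGeodesicSpace X) [MulAction G X] [IsIsometricSMul G X]
    (hfree : IsFreeAction G X) (hcocompact : IsCocompactAction G X)
    [ProperlyDiscontinuousSMul G X]
    (S : SymmGenSet G) (N : Set X) (hN : IsNetIn N)
    (hcard : Finite G → Nat.card N = Nat.card G)
    (o : N) (e : WordSpace S) :
    Nonempty (LipschitzFree N o ≃L[ℝ] LipschitzFree (WordSpace S) e) := by
  have h : Nonempty (FreeSpace N o ≃L[ℝ] FreeSpace (WordSpace S) e) := by
    rcases finite_or_infinite G with hG | hG
    · exact nonempty_equiv_of_finite S N hN (hcard hG) o e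
    · exact nonempty_equiv_of_infinite hX hcocompact S N hN o e
  obtain ⟨a⟩ := h
  exact ⟨((FreeSpace.equivLipschitzFree N o).symm.trans a).trans
    (FreeSpace.equivLipschitzFree (WordSpace S) e)⟩
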